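/- Let $N\ge 1$ and let $\Phi=\{\varphi_i\}_{i=1}^M\subset\mathbb R^N$ be a unit-norm frame, i.e. $\|\varphi_i\|_2=1$ for all $i$ and there are constants $0<A\le B<\infty$ with $A\|x\|_2^2\le\sum_{i=1}^M|\langle x,\varphi_i\rangle|^2\le B\|x\|_2^2$ for all $x\in\mathbb R^N$. A frame is called tight if one can take $A=B$, and $\Phi$ is called scalable if there are scalars $s_1,\dots,s_M\ge 0$ such that $\{s_i\varphi_i\}_{i=1}^M$ is a tight frame for $\mathbb R^N$. Then the minimum $\min_{\|d\|_2=1}\max_{1\le i\le M}|\langle d,\varphi_i\rangle|$ exists, and the following hold. (a) If $\Phi$ is scalable, then $$\min_{\|d\|_2=1}\max_{1\le i\le M}|\langle d,\varphi_i\rangle|\ \ge\ \frac1{\sqrt N}.$$ (b) If $$\min_{\|d\|_2=1}\max_{1\le i\le M}|\langle d,\varphi_i\rangle|\ \ge\ \sqrt{\frac{N-1}{N}},$$ then $\Phi$ is scalable. -/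

import Mathlib

noncomputable section

namespace ScalableFrames

/-- `Φ` satisfies the two-sided frame inequality with bounds `0 < A` and `B`. -/
def HasFrameBounds {M N : ℕ} (Φ : Fin M → EuclideanSpace ℝ (Fin N)) (A B : ℝ) : Prop :=
  0 < A ∧ ∀ x : EuclideanSpace ℝ (Fin N),
    A * ‖x‖ ^ 2 ≤ ∑ i, |inner ℝ x (Φ i)| ^ 2 ∧ ∑ i, |inner ℝ x (Φ i)| ^ 2 ≤ B * ‖x‖ ^ 2

/-- A finite sequence of vectors is a frame for `ℝ^N`. -/
def IsFrame {M N : ℕ} (Φ : Fin M → EuclideanSpace ℝ (Fin N)) : Prop :=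
  ∃ A B : ℝ, HasFrameBounds Φ A B

/-- A tight frame: the two frame bounds can be chosen equal. -/
def IsTightFrame {M N : ℕ} (Φ : Fin M → EuclideanSpace ℝ (Fin N)) : Prop :=
  ∃ A : ℝ, HasFrameBounds Φ A A

/-- A frame all of whose vectors have Euclidean norm one. -/
def IsUnitNormFrame {M N : ℕ} (Φ : Fin M → EuclideanSpace ℝ (Fin N)) : Prop :=
  IsFrame Φ ∧ ∀ i, ‖Φ i‖ = 1

/-- A scalable frame: nonnegative rescaling of its vectors yields a tight frame. -/
def IsScalable {M N : ℕ} (Φ : Fin M → EuclideanSpace ℝ (Fin N)) : Prop :=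
  IsFrame Φ ∧ ∃ s : Fin M → ℝ, (∀ i, 0 ≤ s i) ∧ IsTightFrame (fun i => s i • Φ i)

/-- `max_i |⟨d, φ_i⟩|`; the supremum is over a finite index set, hence a maximum when `0 < M`. -/
def maxCorrelation {M N : ℕ} (Φ : Fin M → EuclideanSpace ℝ (Fin N))
    (d : EuclideanSpace ℝ (Fin N)) : ℝ :=
  ⨆ i, |inner ℝ d (Φ i)|

/-- The infimum over unit vectors `d` of `max_i |⟨d, φ_i⟩|`. -/
def minMaxCorrelation {M N : ℕ} (Φ : Fin M → EuclideanSpace ℝ (Fin N)) : ℝ :=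
  sInf (maxCorrelation Φ '' {d | ‖d‖ = 1})

end ScalableFrames

end

namespace ScalableFrames

open Finset Matrix

section Attainment

variable {M N : ℕ} (Φ : Fin M → EuclideanSpace ℝ (Fin N))

/-! (a) Taking traces in `∑ sᵢ² φᵢφᵢᵀ = A I` gives `∑ sᵢ² = N A` (`sum_sq_eq_of_tight`). So for unit
`d` the `sᵢ²`-weighted mean of `⟨d, φᵢ⟩²` is `1/N`, and the maximum is no smaller.

(b) If `I/N` is a convex combination of the `φᵢφᵢᵀ`, then `Φ` is scalable. Otherwise a hyperplane
separates it from their hull, giving a symmetric `S` with `tr S < N φᵢᵀSφᵢ` for all `i`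
(`exists_isHermitian_trace_lt`). Shift `S` so that its least eigenvalue is `0`, with unit
eigenvector `d`. Then `S ≤ (tr S)(I - ddᵀ)`, which forces `⟨d, φᵢ⟩² < (N-1)/N`
(`exists_unit_sq_inner_lt`). -/

lemma abs_inner_le_maxCorrelation (d : EuclideanSpace ℝ (Fin N)) (i : Fin M) :
    |inner ℝ d (Φ i)| ≤ maxCorrelation Φ d :=
  le_ciSup (f := fun i => |inner ℝ d (Φ i)|) (Set.finite_range _).bddAbove i

lemma maxCorrelation_nonneg (d : EuclideanSpace ℝ (Fin N)) : 0 ≤ maxCorrelation Φ d :=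
  Real.iSup_nonneg fun _ => abs_nonneg _

/-- The maximal correlation is a Lipschitz function, hence continuous. -/
lemma continuous_maxCorrelation (hΦ : ∀ i, ‖Φ i‖ = 1) : Continuous (maxCorrelation Φ) := by
  refine (LipschitzWith.of_le_add_mul 1 fun x y => ?_).continuous
  -- For `M = 0` the supremum is `0`, so the bound must also be nonnegative.
  refine Real.iSup_le (fun i => ?_)
    (add_nonneg (maxCorrelation_nonneg Φ y) (by positivity))
  have h1 : inner ℝ x (Φ i) = inner ℝ y (Φ i) + inner ℝ (x - y) (Φ i) := by
    rw [inner_sub_left]; ring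
  have h2 : |inner ℝ (x - y) (Φ i)| ≤ dist x y := by
    have := abs_real_inner_le_norm (x - y) (Φ i)
    rwa [hΦ i, mul_one, ← dist_eq_norm] at this
  calc |inner ℝ x (Φ i)| ≤ |inner ℝ y (Φ i)| + |inner ℝ (x - y) (Φ i)| := by
        rw [h1]; exact abs_add_le _ _
    _ ≤ maxCorrelation Φ y + ((1 : NNReal) : ℝ) * dist x y := by
        rw [NNReal.coe_one, one_mul]
        exact add_le_add (abs_inner_le_maxCorrelation Φ y i) h2

lemma isLeast_minMaxCorrelation (hN : 0 < N) (hΦ : ∀ i, ‖Φ i‖ = 1) :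
    IsLeast (maxCorrelation Φ '' {d | ‖d‖ = 1}) (minMaxCorrelation Φ) := by
  have hS : {d : EuclideanSpace ℝ (Fin N) | ‖d‖ = 1} = Metric.sphere 0 1 := by
    ext d; simp
  refine IsCompact.isLeast_sInf ?_ ?_
  · rw [hS]
    exact (isCompact_sphere 0 1).image (continuous_maxCorrelation Φ hΦ)
  · exact ⟨_, EuclideanSpace.single ⟨0, hN⟩ 1, by simp, rfl⟩

end Attainment

section Necessity

variable {M N : ℕ} {Φ : Fin M → EuclideanSpace ℝ (Fin N)}

/-- The weights of a tight scaling of unit vectors sum to `N` times the frame bound. -/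
lemma sum_sq_eq_of_tight (hΦ : ∀ i, ‖Φ i‖ = 1) {s : Fin M → ℝ} {A : ℝ}
    (hA : ∀ x : EuclideanSpace ℝ (Fin N), ∑ i, s i ^ 2 * inner ℝ x (Φ i) ^ 2 = A * ‖x‖ ^ 2) :
    ∑ i, s i ^ 2 = N * A := by
  have h1 : ∀ i, ∑ j, inner ℝ (EuclideanSpace.basisFun (Fin N) ℝ j) (Φ i) ^ 2 = 1 := by
    intro i
    have := (EuclideanSpace.basisFun (Fin N) ℝ).sum_sq_norm_inner_right (Φ i)
    simpa [hΦ i] using this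
  calc ∑ i, s i ^ 2
      = ∑ i, ∑ j, s i ^ 2 * inner ℝ (EuclideanSpace.basisFun (Fin N) ℝ j) (Φ i) ^ 2 := by
        refine sum_congr rfl fun i _ => ?_
        rw [← mul_sum, h1, mul_one]
    _ = ∑ j : Fin N, A := by
        rw [sum_comm]
        refine sum_congr rfl fun j _ => ?_
        rw [hA, OrthonormalBasis.norm_eq_one]; ring
    _ = N * A := by simp

lemma one_div_sqrt_le_maxCorrelation (hN : 0 < N) (hΦ : ∀ i, ‖Φ i‖ = 1) (h : IsScalable Φ)
    {d : EuclideanSpace ℝ (Fin N)} (hd : ‖d‖ = 1) :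
    1 / √(N : ℝ) ≤ maxCorrelation Φ d := by
  obtain ⟨-, s, -, A, hA0, hA⟩ := h
  have hA' : ∀ x : EuclideanSpace ℝ (Fin N),
      ∑ i, s i ^ 2 * inner ℝ x (Φ i) ^ 2 = A * ‖x‖ ^ 2 := by
    intro x
    rw [← le_antisymm (hA x).2 (hA x).1]
    refine sum_congr rfl fun i _ => ?_
    rw [sq_abs, inner_smul_right, mul_pow]
  have hsum := sum_sq_eq_of_tight hΦ hA'
  have hN' : (0 : ℝ) < N := by exact_mod_cast hN
  set m := maxCorrelation Φ d with hm
  have hm0 : 0 ≤ m := maxCorrelation_nonneg Φ d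
  have hle : A ≤ A * (N * m ^ 2) := by
    calc A = ∑ i, s i ^ 2 * inner ℝ d (Φ i) ^ 2 := by rw [hA', hd]; ring
      _ ≤ ∑ i, s i ^ 2 * m ^ 2 := by
        refine sum_le_sum fun i _ => mul_le_mul_of_nonneg_left ?_ (sq_nonneg _)
        rw [← sq_abs]
        exact pow_le_pow_left₀ (abs_nonneg _) (abs_inner_le_maxCorrelation Φ d i) 2
      _ = A * (N * m ^ 2) := by rw [← sum_mul, hsum]; ring
  have h1 : 1 ≤ N * m ^ 2 := by
    by_contra! hlt
    nlinarith
  rw [← Real.sqrt_one, ← Real.sqrt_div zero_le_one]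
  refine Real.sqrt_le_iff.mpr ⟨hm0, ?_⟩
  rw [div_le_iff₀ hN']; linarith

end Necessity

section Sufficiency

variable {M N : ℕ}

/-- If a symmetric matrix takes a value larger than its mean eigenvalue at each of a family of
unit vectors, then an eigenvector of the least eigenvalue is far from all of them. -/
lemma exists_unit_sq_inner_lt (hN : 0 < N) {S : Matrix (Fin N) (Fin N) ℝ} (hS : S.IsHermitian) :
    ∃ d : EuclideanSpace ℝ (Fin N), ‖d‖ = 1 ∧ ∀ x : EuclideanSpace ℝ (Fin N), ‖x‖ = 1 →
      S.trace < N * (x.ofLp ⬝ᵥ S *ᵥ x.ofLp) → inner ℝ d x ^ 2 < ((N : ℝ) - 1) / N := by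
  have : Nonempty (Fin N) := ⟨⟨0, hN⟩⟩
  have hN' : (0 : ℝ) < N := by exact_mod_cast hN
  set l := hS.eigenvalues with hl
  set b := hS.eigenvectorBasis with hb
  obtain ⟨k, hk⟩ := Finite.exists_min l
  refine ⟨b k, b.norm_eq_one k, fun x hx hlt => ?_⟩
  have htr : S.trace = ∑ j, l j := by simpa using hS.trace_eq_sum_eigenvalues
  have hquad : x.ofLp ⬝ᵥ S *ᵥ x.ofLp = ∑ j, l j * inner ℝ (b j) x ^ 2 := by
    have h1 : x.ofLp ⬝ᵥ S *ᵥ x.ofLp = inner ℝ x (WithLp.toLp 2 (S *ᵥ x.ofLp)) := by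
      rw [PiLp.inner_apply]
      simp [dotProduct, mul_comm]
    rw [h1, ← b.sum_inner_mul_inner]
    refine sum_congr rfl fun j _ => ?_
    have h2 : inner ℝ (b j) (WithLp.toLp 2 (S *ᵥ x.ofLp)) = l j * inner ℝ (b j) x := by
      have h3 : S *ᵥ (b j).ofLp = l j • (b j).ofLp := hS.mulVec_eigenvectorBasis j
      have h4 : inner ℝ (b j) (WithLp.toLp 2 (S *ᵥ x.ofLp))
          = (b j).ofLp ⬝ᵥ S *ᵥ x.ofLp := by
        rw [PiLp.inner_apply]
        simp [dotProduct, mul_comm]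
      have h5 : inner ℝ (b j) x = (b j).ofLp ⬝ᵥ x.ofLp := by
        rw [PiLp.inner_apply]
        simp [dotProduct, mul_comm]
      have hSt : Sᵀ = S := by simpa using hS.eq
      rw [h4, h5, dotProduct_mulVec, ← mulVec_transpose, hSt, h3, smul_dotProduct, smul_eq_mul]
    rw [h2, real_inner_comm x]; ring
  have hone : ∑ j, inner ℝ (b j) x ^ 2 = 1 := by
    have := b.sum_sq_norm_inner_right x
    simpa [hx] using this
  rw [htr, hquad] at hlt
  have htop : ∀ j ≠ k, l j - l k ≤ ∑ i, (l i - l k) := fun j _ =>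
    single_le_sum (f := fun i => l i - l k) (fun i _ => sub_nonneg.mpr (hk i)) (mem_univ j)
  -- The trace of the shifted matrix `S - l k • 1`, which is positive semidefinite.
  set T := ∑ i, (l i - l k) with hT
  have hT0 : 0 ≤ T := sum_nonneg fun i _ => sub_nonneg.mpr (hk i)
  have hTs : T = ∑ i, l i - N * l k := by simp [hT, sum_sub_distrib]
  -- The term `j = k` vanishes; the other squared coordinates sum to `1 - ⟨b k, x⟩²`.
  have hbound : ∑ j, (l j - l k) * inner ℝ (b j) x ^ 2 ≤ T * (1 - inner ℝ (b k) x ^ 2) := by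
    rw [← hone, ← sum_erase_eq_sub (mem_univ k), mul_sum,
      ← sum_erase univ (a := k) (by simp)]
    refine sum_le_sum fun j hj => mul_le_mul_of_nonneg_right ?_ (sq_nonneg _)
    exact htop j (ne_of_mem_erase hj)
  have hsplit : ∑ j, (l j - l k) * inner ℝ (b j) x ^ 2
      = ∑ j, l j * inner ℝ (b j) x ^ 2 - l k := by
    simp only [sub_mul, sum_sub_distrib]
    rw [← mul_sum, hone, mul_one]
  rw [hsplit] at hbound
  have hfin : T * 1 < T * (N * (1 - inner ℝ (b k) x ^ 2)) := by nlinarith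
  have := lt_of_mul_lt_mul_left hfin hT0
  rw [lt_div_iff₀ hN']; linarith

/-- The linear map sending weights `w` to the weighted sum of the outer products `φᵢ φᵢᵀ`. -/
def weightedOuterSum (Φ : Fin M → EuclideanSpace ℝ (Fin N)) :
    (Fin M → ℝ) →ₗ[ℝ] (Fin N → Fin N → ℝ) where
  toFun w a b := ∑ i, w i * (Φ i a * Φ i b)
  map_add' v w := by ext a b; simp [add_mul, sum_add_distrib]
  map_smul' c w := by ext a b; simp [mul_sum, mul_assoc]

lemma weightedOuterSum_apply (Φ : Fin M → EuclideanSpace ℝ (Fin N)) (w : Fin M → ℝ)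
    (a b : Fin N) : weightedOuterSum Φ w a b = ∑ i, w i * (Φ i a * Φ i b) := rfl

/-- A linear functional on matrices is the pairing with a fixed matrix. -/
lemma linearMap_apply_eq_sum (f : (Fin N → Fin N → ℝ) →ₗ[ℝ] ℝ) (X : Fin N → Fin N → ℝ) :
    f X = ∑ a, ∑ b, X a b * f (Pi.single a (Pi.single b 1)) := by
  have hX : X = ∑ a, ∑ b, X a b • (Pi.single a (Pi.single b 1) : Fin N → Fin N → ℝ) := by
    ext c d
    simp [Finset.sum_apply, Pi.single_apply, ite_apply]
  conv_lhs => rw [hX]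
  simp

/-- The scaling is `√(w i)`: expanding the squared inner products turns the matrix identity into
tightness with bound `1/N`. -/
lemma isScalable_of_weightedOuterSum_eq (hN : 0 < N) {Φ : Fin M → EuclideanSpace ℝ (Fin N)}
    (hΦ : IsFrame Φ) {w : Fin M → ℝ} (hw : ∀ i, 0 ≤ w i)
    (h : weightedOuterSum Φ w = fun a b => if a = b then (1 : ℝ) / N else 0) :
    IsScalable Φ := by
  have hN' : (0 : ℝ) < N := by exact_mod_cast hN
  refine ⟨hΦ, fun i => √(w i), fun i => Real.sqrt_nonneg _, 1 / N, by positivity, fun x => ?_⟩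
  have key : ∑ i, |inner ℝ x (√(w i) • Φ i)| ^ 2 = 1 / N * ‖x‖ ^ 2 := by
    have hx : ‖x‖ ^ 2 = ∑ a, x a * x a := by
      rw [EuclideanSpace.norm_sq_eq]
      exact sum_congr rfl fun a _ => by rw [Real.norm_eq_abs, sq_abs, sq]
    calc ∑ i, |inner ℝ x (√(w i) • Φ i)| ^ 2
        = ∑ i, ∑ a, ∑ b, x a * x b * (w i * (Φ i a * Φ i b)) := by
          refine sum_congr rfl fun i _ => ?_
          have hi : inner ℝ x (Φ i) = ∑ a, x a * Φ i a := by
            rw [PiLp.inner_apply]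
            simp [mul_comm]
          rw [sq_abs, inner_smul_right, mul_pow, Real.sq_sqrt (hw i), hi, sq, sum_mul_sum, mul_sum]
          refine sum_congr rfl fun a _ => ?_
          rw [mul_sum]
          exact sum_congr rfl fun b _ => by ring
      _ = ∑ a, ∑ b, x a * x b * weightedOuterSum Φ w a b := by
          rw [sum_comm]
          refine sum_congr rfl fun a _ => ?_
          rw [sum_comm]
          exact sum_congr rfl fun b _ => by rw [weightedOuterSum_apply, mul_sum]
      _ = 1 / N * ‖x‖ ^ 2 := by
          rw [h, hx, mul_sum]
          refine sum_congr rfl fun a _ => ?_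
          simp [mul_comm]
  exact ⟨key.ge, key.le⟩

/-- A non-scalable frame admits a symmetric matrix whose quadratic form exceeds the mean
eigenvalue at all frame vectors. -/
lemma exists_isHermitian_trace_lt (hN : 0 < N) {Φ : Fin M → EuclideanSpace ℝ (Fin N)}
    (hΦ : IsFrame Φ) (hns : ¬ IsScalable Φ) :
    ∃ S : Matrix (Fin N) (Fin N) ℝ, S.IsHermitian ∧
      ∀ i, S.trace < N * ((Φ i).ofLp ⬝ᵥ S *ᵥ (Φ i).ofLp) := by
  have hN' : (0 : ℝ) < N := by exact_mod_cast hN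
  set L := weightedOuterSum Φ with hL
  have hcompact : IsCompact (L '' stdSimplex ℝ (Fin M)) :=
    (isCompact_stdSimplex ℝ (Fin M)).image L.continuous_of_finiteDimensional
  have hnot : (fun a b => if a = b then (1 : ℝ) / N else 0 : Fin N → Fin N → ℝ) ∉
      L '' stdSimplex ℝ (Fin M) := by
    rintro ⟨w, hw, hwL⟩
    exact hns (isScalable_of_weightedOuterSum_eq hN hΦ hw.1 hwL)
  obtain ⟨f, u, hfu, huf⟩ := geometric_hahn_banach_point_closed
    ((convex_stdSimplex ℝ (Fin M)).linear_image L) hcompact.isClosed hnot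
  set Y : Matrix (Fin N) (Fin N) ℝ :=
    Matrix.of fun a b => f (Pi.single a (Pi.single b 1)) with hY
  have hf : ∀ X : Fin N → Fin N → ℝ, f X = ∑ a, ∑ b, X a b * Y a b := fun X =>
    linearMap_apply_eq_sum f.toLinearMap X
  -- Symmetrizing doubles both the trace and the quadratic form, so the strict inequality survives.
  refine ⟨Y + Yᵀ, by simp [IsHermitian, conjTranspose_eq_transpose_of_trivial, add_comm],
    fun i => ?_⟩
  have h1 : (Y + Yᵀ).trace
      = 2 * (N * f (fun a b => if a = b then (1 : ℝ) / N else 0)) := by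
    rw [hf, trace_add, trace_transpose, trace]
    simp only [ite_mul, zero_mul, sum_ite_eq, mem_univ, if_true, diag_apply, ← mul_sum]
    field_simp
    ring
  have h2 : (Φ i).ofLp ⬝ᵥ (Y + Yᵀ) *ᵥ (Φ i).ofLp = 2 * f (L (Pi.single i 1)) := by
    have h3 : (Φ i).ofLp ⬝ᵥ Y *ᵥ (Φ i).ofLp = f (L (Pi.single i 1)) := by
      rw [hf, dotProduct]
      refine sum_congr rfl fun a _ => ?_
      rw [mulVec, dotProduct, mul_sum]
      refine sum_congr rfl fun b _ => ?_
      rw [hL, weightedOuterSum_apply]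
      simp [Pi.single_apply]
      ring
    rw [add_mulVec, dotProduct_add, mulVec_transpose, dotProduct_comm (Φ i).ofLp (_ ᵥ* _),
      ← dotProduct_mulVec, h3]
    ring
  -- The simplex vertex at `i` maps to `φᵢφᵢᵀ`.
  have h4 := hfu.trans (huf _ ⟨_, single_mem_stdSimplex ℝ i, rfl⟩)
  rw [h1, h2]
  nlinarith

lemma isScalable_of_sqrt_le (hN : 0 < N) {Φ : Fin M → EuclideanSpace ℝ (Fin N)}
    (hΦ : IsFrame Φ) (hΦ1 : ∀ i, ‖Φ i‖ = 1)
    (h : ∀ d : EuclideanSpace ℝ (Fin N), ‖d‖ = 1 →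
      √(((N : ℝ) - 1) / (N : ℝ)) ≤ maxCorrelation Φ d) : IsScalable Φ := by
  by_contra hns
  obtain ⟨S, hS, hSΦ⟩ := exists_isHermitian_trace_lt hN hΦ hns
  obtain ⟨d, hd, hdx⟩ := exists_unit_sq_inner_lt hN hS
  -- An empty family violates the lower frame bound at `d`; nonemptiness makes the supremum
  -- attained.
  have hM : Nonempty (Fin M) := by
    by_contra hM
    rw [not_nonempty_iff] at hM
    obtain ⟨A, B, hA, hAB⟩ := hΦ
    have := (hAB d).1
    rw [hd] at this
    simp at this
    linarith
  obtain ⟨i, hi⟩ := exists_eq_ciSup_of_finite (f := fun i => |inner ℝ d (Φ i)|)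
  have hlt : |inner ℝ d (Φ i)| < √(((N : ℝ) - 1) / (N : ℝ)) := by
    refine Real.lt_sqrt_of_sq_lt ?_
    rw [sq_abs]
    exact hdx _ (hΦ1 i) (hSΦ i)
  have := h d hd
  rw [maxCorrelation, ← hi] at this
  exact absurd this (not_le.mpr hlt)

end Sufficiency

end ScalableFrames

/-- The first conjunct says that the infimum in `minMaxCorrelation` is attained, so that it is
the minimum in the other two. -/
theorem theorem4p1 (M N : ℕ) (hN : 0 < N) (Φ : Fin M → EuclideanSpace ℝ (Fin N))
    (hΦ : ScalableFrames.IsUnitNormFrame Φ) :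
    IsLeast (ScalableFrames.maxCorrelation Φ '' {d | ‖d‖ = 1})
        (ScalableFrames.minMaxCorrelation Φ) ∧
    (ScalableFrames.IsScalable Φ →
      1 / √(N : ℝ) ≤ ScalableFrames.minMaxCorrelation Φ) ∧
    (√(((N : ℝ) - 1) / (N : ℝ)) ≤ ScalableFrames.minMaxCorrelation Φ →
      ScalableFrames.IsScalable Φ) := by
  have hleast := ScalableFrames.isLeast_minMaxCorrelation Φ hN hΦ.2
  refine ⟨hleast, fun h => ?_, fun h => ?_⟩
  · obtain ⟨d, hd, hdm⟩ := hleast.1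
    rw [← hdm]
    exact ScalableFrames.one_div_sqrt_le_maxCorrelation hN hΦ.2 h hd
  · exact ScalableFrames.isScalable_of_sqrt_le hN hΦ.1 hΦ.2 fun d hd =>
      h.trans (hleast.2 ⟨d, hd, rfl⟩)
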